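/- **Theorem 1.8.** Let $c>1$, let $k\ge 1$ be an integer, and let $a,b\in[0,\infty)$ be not both zero. For $q\in(0,\infty)\setminus\{1\}$ put $[x]_q=\frac{q^x-1}{q-1}$. A $q$-Pólya urn is an urn with white and black balls (not empty initially) to which, at each drawing, $k$ balls are added: if the present composition is $w$ white and $s$ black balls, then, given the past, the $k$ added balls are white with probability $[w]_q/[w+s]_q$ and black otherwise. For each integer $m\ge1$ consider a $q_m$-Pólya urn with $q_m=c^{1/m}$ and (deterministic) initial composition of $A^{(m)}_0$ white and $B^{(m)}_0$ black balls, and let $A^{(m)}_n$ be the number of white balls after $n$ drawings. Assume that $$\lim_{m\to\infty}\frac{A^{(m)}_0}{m}=a,\qquad \lim_{m\to\infty}\frac{B^{(m)}_0}{m}=b .$$ Then, as $m\to\infty$, the process $\big(A^{(m)}_{[mt]}/m\big)_{t\ge0}$ converges in distribution, in the space $D_{\mathbb R}[0,\infty)$ of right continuous functions with left limits with the Skorokhod topology, to the (deterministic) unique solution $(\hat X_t)_{t\ge 0}$ of the differential equation $$\hat X_0=a,\qquad d\hat X_t=k\,\frac{1-c^{\hat X_t}}{1-c^{a+b+kt}}\,dt,\qquad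 t\ge0,$$ which is $$\hat X_t=a-\frac1{\log c}\,\log\!\left(\frac{c^b-1+c^{-kt}(1-c^{-a})}{c^b-c^{-a}}\right).$$ -/

import Mathlib

open Set Filter Topology MeasureTheory ProbabilityTheory
open scoped NNReal

/-- A function `f : [0, ∞) → ℝ` is càdlàg if it is right continuous and has a (finite) limit from
the left at each point.  (At `t = 0` the second condition is empty, since `𝓝[<] 0 = ⊥`.) -/
def IsCadlag (f : ℝ≥0 → ℝ) : Prop :=
  ∀ t : ℝ≥0, ContinuousWithinAt f (Ici t) t ∧ ∃ l : ℝ, Tendsto f (𝓝[<] t) (𝓝 l)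

/-- The Skorokhod space `D_ℝ[0, ∞)` of càdlàg functions `[0, ∞) → ℝ`. -/
structure SkorokhodSpace where
  /-- the underlying path -/
  path : ℝ≥0 → ℝ
  /-- the path is right continuous with left limits -/
  isCadlag : IsCadlag path

namespace SkorokhodSpace

instance : CoeFun SkorokhodSpace (fun _ => ℝ≥0 → ℝ) := ⟨path⟩

/-- The basic Skorokhod neighbourhood of `f` with parameters `T` and `ε`: all `g` for which there is
a time change `lam` (an increasing bijection of `[0, ∞)`) with `|lam t - t| < ε` and
`|g t - f (lam t)| < ε` for all `t ∈ [0, T]`. -/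
def basicNhd (f : SkorokhodSpace) (T : ℝ≥0) (ε : ℝ) : Set SkorokhodSpace :=
  {g | ∃ lam : ℝ≥0 ≃o ℝ≥0, ∀ t ≤ T, |(lam t : ℝ) - t| < ε ∧ |g t - f (lam t)| < ε}

lemma basicNhd_mono (f : SkorokhodSpace) {T T' : ℝ≥0} {ε ε' : ℝ} (hT : T' ≤ T) (hε : ε ≤ ε') :
    basicNhd f T ε ⊆ basicNhd f T' ε' := by
  rintro g ⟨lam, h⟩
  exact ⟨lam, fun t ht => ⟨(h t (ht.trans hT)).1.trans_le hε, (h t (ht.trans hT)).2.trans_le hε⟩⟩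

/-- The Skorokhod (J1) topology on `D_ℝ[0, ∞)`: `U` is open iff it contains with each `f` some
`basicNhd f T ε`.  It is the topology in which `f_n → f` iff for every `T` there are increasing
bijections `lam_n` of `[0, ∞)` with `sup_{t ≤ T} |lam_n t - t| → 0` and
`sup_{t ≤ T} |f_n t - f (lam_n t)| → 0`, the usual description of convergence in the Skorokhod
metric. -/
instance : TopologicalSpace SkorokhodSpace where
  IsOpen U := ∀ f ∈ U, ∃ T : ℝ≥0, ∃ ε > 0, basicNhd f T ε ⊆ U
  isOpen_univ := fun _ _ => ⟨0, 1, one_pos, subset_univ _⟩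
  isOpen_inter := by
    rintro U V hU hV f ⟨hfU, hfV⟩
    obtain ⟨T, ε, hε, h⟩ := hU f hfU
    obtain ⟨T', ε', hε', h'⟩ := hV f hfV
    exact ⟨max T T', min ε ε', lt_min hε hε', subset_inter
      ((basicNhd_mono f (le_max_left _ _) (min_le_left _ _)).trans h)
      ((basicNhd_mono f (le_max_right _ _) (min_le_right _ _)).trans h')⟩
  isOpen_sUnion := by
    rintro S hS f ⟨U, hU, hf⟩
    obtain ⟨T, ε, hε, h⟩ := hS U hU f hf
    exact ⟨T, ε, hε, h.trans (subset_sUnion_of_mem hU)⟩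

/-- `D_ℝ[0, ∞)` carries the Borel σ-algebra of the Skorokhod topology. -/
instance : MeasurableSpace SkorokhodSpace := borel SkorokhodSpace

instance : BorelSpace SkorokhodSpace := ⟨rfl⟩

end SkorokhodSpace

/-- For a sequence `x` and `m ≥ 1`, the step function `t ↦ x_{[m t]}` is càdlàg. -/
lemma isCadlag_comp_floor (x : ℕ → ℝ) (m : ℕ+) :
    IsCadlag (fun t : ℝ≥0 => x ⌊(m : ℝ≥0) * t⌋₊) := by
  have hm : (0 : ℝ≥0) < (m : ℝ≥0) := by exact_mod_cast m.pos
  intro t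
  constructor
  · have h : ∀ᶠ s in 𝓝[≥] t, x ⌊(m : ℝ≥0) * s⌋₊ = x ⌊(m : ℝ≥0) * t⌋₊ := by
      have h1 : ∀ᶠ s in 𝓝 t, (m : ℝ≥0) * s < (⌊(m : ℝ≥0) * t⌋₊ : ℝ≥0) + 1 :=
        (continuous_const.mul continuous_id).continuousAt.eventually_lt continuousAt_const
          (Nat.lt_floor_add_one _)
      filter_upwards [nhdsWithin_le_nhds h1, self_mem_nhdsWithin] with s hs hts
      congr 1
      refine le_antisymm ?_ (Nat.floor_mono (mul_le_mul_of_nonneg_left hts hm.le))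
      exact Nat.lt_succ_iff.1 ((Nat.floor_lt zero_le).2 (by exact_mod_cast hs))
    exact (tendsto_const_nhds.congr' (h.mono fun s hs => hs.symm))
  · refine ⟨x (⌈(m : ℝ≥0) * t⌉₊ - 1), ?_⟩
    have h : ∀ᶠ s in 𝓝[<] t, x ⌊(m : ℝ≥0) * s⌋₊ = x (⌈(m : ℝ≥0) * t⌉₊ - 1) := by
      rcases eq_or_ne t 0 with rfl | ht
      · simp
      have hpos : 0 < (m : ℝ≥0) * t := mul_pos hm (pos_iff_ne_zero.2 ht)
      have hc : 0 < ⌈(m : ℝ≥0) * t⌉₊ := Nat.ceil_pos.2 hpos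
      have hlt : ((⌈(m : ℝ≥0) * t⌉₊ - 1 : ℕ) : ℝ≥0) < (m : ℝ≥0) * t :=
        Nat.lt_ceil.1 (Nat.sub_lt hc one_pos)
      have h1 : ∀ᶠ s in 𝓝 t, ((⌈(m : ℝ≥0) * t⌉₊ - 1 : ℕ) : ℝ≥0) < (m : ℝ≥0) * s :=
        continuousAt_const.eventually_lt (continuous_const.mul continuous_id).continuousAt hlt
      filter_upwards [nhdsWithin_le_nhds h1, self_mem_nhdsWithin] with s hs hts
      congr 1
      refine le_antisymm ?_ (Nat.le_floor hs.le)
      have h2 : (m : ℝ≥0) * s < ⌈(m : ℝ≥0) * t⌉₊ :=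
        (mul_lt_mul_of_pos_left hts hm).trans_le (Nat.le_ceil _)
      have := (Nat.floor_lt zero_le).2 h2
      omega
    exact (tendsto_const_nhds.congr' (h.mono fun s hs => hs.symm))

/-- The rescaled path `(x_{[m t]} / m)_{t ≥ 0}` of a sequence `x`, as an element of
`D_ℝ[0, ∞)`. -/
noncomputable def rescaledPath (m : ℕ+) (x : ℕ → ℕ) : SkorokhodSpace where
  path t := (x ⌊(m : ℝ≥0) * t⌋₊ : ℝ) / m
  isCadlag := isCadlag_comp_floor (fun n => (x n : ℝ) / m) m

/-- The `q`-number `[x]_q = (q ^ x - 1) / (q - 1)`. -/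
noncomputable def qNumber (q x : ℝ) : ℝ := (q ^ x - 1) / (q - 1)

/-- `(A n, B n)` is the composition (white, black) after `n` drawings of a `q`-Pólya urn which
starts from `r` white and `s` black balls: at each drawing `k` balls of one of the two colours are
added, and if the present composition is `(w, b)`, then, given the past, white balls are added with
probability `[w]_q / [w + b]_q` (and black balls otherwise). -/
structure IsQPolyaUrn {Ω : Type*} [MeasurableSpace Ω] (P : Measure Ω) (q : ℝ) (k r s : ℕ)
    (A B : ℕ → Ω → ℕ) : Prop where
  measurable_white : ∀ n, Measurable (A n)
  measurable_black : ∀ n, Measurable (B n)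
  init : ∀ᵐ ω ∂P, A 0 ω = r ∧ B 0 ω = s
  step : ∀ n, ∀ᵐ ω ∂P, (A (n + 1) ω = A n ω + k ∧ B (n + 1) ω = B n ω) ∨
    (A (n + 1) ω = A n ω ∧ B (n + 1) ω = B n ω + k)
  prob_white : ∀ (n : ℕ) (w b : ℕ → ℕ),
    P.real {ω | (∀ i ≤ n, A i ω = w i ∧ B i ω = b i) ∧
        A (n + 1) ω = w n + k ∧ B (n + 1) ω = b n} =
      qNumber q (w n) / qNumber q (w n + b n) *
        P.real {ω | ∀ i ≤ n, A i ω = w i ∧ B i ω = b i}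

lemma qNumber_nonneg {q x : ℝ} (hq : 0 < q) (hx : 0 ≤ x) : 0 ≤ qNumber q x := by
  unfold qNumber
  rcases le_total 1 q with h | h
  · exact div_nonneg (sub_nonneg.2 (Real.one_le_rpow h hx)) (sub_nonneg.2 h)
  · exact div_nonneg_of_nonpos (sub_nonpos.2 (Real.rpow_le_one hq.le h hx)) (sub_nonpos.2 h)

lemma qNumber_mono {q x y : ℝ} (hq : 0 < q) (hxy : x ≤ y) : qNumber q x ≤ qNumber q y := by
  unfold qNumber
  rcases le_total 1 q with h | h
  · exact div_le_div_of_nonneg_right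
      (sub_le_sub_right (Real.rpow_le_rpow_of_exponent_le h hxy) 1) (sub_nonneg.2 h)
  · exact div_le_div_of_nonpos_of_le (sub_nonpos.2 h)
      (sub_le_sub_right (Real.rpow_le_rpow_of_exponent_ge hq h hxy) 1)

/-- The composition of a `q`-Pólya urn driven by a sequence `u` of numbers in `[0, 1]`: the `n`-th
drawing gives white iff `u n` is less than the probability of white. -/
noncomputable def qPolyaState (q : ℝ) (k r s : ℕ) (u : ℕ → ℝ) : ℕ → ℕ × ℕ
  | 0 => (r, s)
  | n + 1 =>
    let z := qPolyaState q k r s u n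
    open Classical in
    if u n < qNumber q z.1 / qNumber q (z.1 + z.2) then (z.1 + k, z.2) else (z.1, z.2 + k)

lemma measurable_qPolyaState (q : ℝ) (k r s n : ℕ) :
    Measurable (fun u => qPolyaState q k r s u n) := by
  induction n with
  | zero => exact measurable_const
  | succ n ih =>
    simp only [qPolyaState]
    refine Measurable.ite ?_ ?_ ?_
    · refine measurableSet_lt (measurable_pi_apply n) ?_
      exact (measurable_of_countable
        (fun z : ℕ × ℕ => qNumber q z.1 / qNumber q (z.1 + z.2))).comp ih
    · exact (measurable_of_countable (fun z : ℕ × ℕ => (z.1 + k, z.2))).comp ih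
    · exact (measurable_of_countable (fun z : ℕ × ℕ => (z.1, z.2 + k))).comp ih

lemma qPolyaState_congr (q : ℝ) (k r s : ℕ) {u v : ℕ → ℝ} (n : ℕ) (h : ∀ i < n, u i = v i) :
    qPolyaState q k r s u n = qPolyaState q k r s v n := by
  induction n with
  | zero => rfl
  | succ n ih =>
    have := ih fun i hi => h i (hi.trans n.lt_succ_self)
    simp only [qPolyaState, this, h n n.lt_succ_self]

/-- `q`-Pólya urns exist: drive one by independent uniform random variables. -/
lemma exists_isQPolyaUrn {q : ℝ} (hq : 0 < q) {k : ℕ} (hk : 0 < k) (r s : ℕ) :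
    ∃ (P : Measure (ℕ → ℝ)) (A B : ℕ → (ℕ → ℝ) → ℕ),
      IsProbabilityMeasure P ∧ IsQPolyaUrn P q k r s A B := by
  let ν : Measure ℝ := volume.restrict (Icc 0 1)
  have : IsProbabilityMeasure ν := ⟨by simp [ν]⟩
  let P : Measure (ℕ → ℝ) := Measure.infinitePi (fun _ => ν)
  have hmeas := measurable_qPolyaState q k r s
  refine ⟨P, fun n u => (qPolyaState q k r s u n).1, fun n u => (qPolyaState q k r s u n).2,
    inferInstance, fun n => (hmeas n).fst, fun n => (hmeas n).snd,
    Eventually.of_forall fun u => ⟨rfl, rfl⟩, fun n => Eventually.of_forall fun u => ?_,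
    fun n w b => ?_⟩
  · simp only [qPolyaState]
    split_ifs <;> simp
  set p : ℝ := qNumber q (w n) / qNumber q (w n + b n) with hp
  have hw0 := qNumber_nonneg hq (Nat.cast_nonneg (α := ℝ) (w n))
  have hwb := qNumber_mono hq (le_add_of_nonneg_right (Nat.cast_nonneg (α := ℝ) (b n)) :
    (w n : ℝ) ≤ w n + b n)
  have hp0 : 0 ≤ p := div_nonneg hw0 (hw0.trans hwb)
  have hp1 : p ≤ 1 := div_le_one_of_le₀ hwb (hw0.trans hwb)
  let H : Set (ℕ → ℝ) := {u | ∀ i ≤ n, (qPolyaState q k r s u i).1 = w i ∧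
    (qPolyaState q k r s u i).2 = b i}
  have hH : MeasurableSet H := by
    have : H = ⋂ i, ⋂ (_ : i ≤ n), (fun u => qPolyaState q k r s u i) ⁻¹' {(w i, b i)} := by
      ext u; simp [H, Prod.ext_iff]
    rw [this]
    exact MeasurableSet.iInter fun i => MeasurableSet.iInter fun _ =>
      hmeas i (measurableSet_singleton _)
  let ext : (Finset.range n → ℝ) → ℕ → ℝ := fun g i =>
    if h : i ∈ Finset.range n then g ⟨i, h⟩ else 0
  have hext : Measurable ext := by
    refine measurable_pi_lambda _ fun i => ?_
    by_cases h : i ∈ Finset.range n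
    · simpa only [ext, h, dite_true] using measurable_pi_apply _
    · simpa only [ext, h, dite_false] using measurable_const
  have hHS : H = (fun (u : ℕ → ℝ) (i : Finset.range n) => u i) ⁻¹' (ext ⁻¹' H) := by
    ext u
    have : ∀ i ≤ n, qPolyaState q k r s (ext fun j : Finset.range n => u j) i =
        qPolyaState q k r s u i := fun i hi =>
      qPolyaState_congr q k r s i fun j hj => by
        have : j < n := hj.trans_le hi
        simp [ext, this]
    simp only [H, mem_preimage, Set.mem_ofPred_eq]
    exact forall₂_congr fun i hi => by rw [this i hi]
  have hE : {u : ℕ → ℝ | (∀ i ≤ n, (qPolyaState q k r s u i).1 = w i ∧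
      (qPolyaState q k r s u i).2 = b i) ∧ (qPolyaState q k r s u (n + 1)).1 = w n + k ∧
      (qPolyaState q k r s u (n + 1)).2 = b n} =
      H ∩ (fun (u : ℕ → ℝ) (i : ({n} : Finset ℕ)) => u i) ⁻¹'
        ((fun g => g ⟨n, Finset.mem_singleton_self n⟩) ⁻¹' Iio p) := by
    ext u
    simp only [Set.mem_ofPred_eq, mem_inter_iff, H, mem_preimage, mem_Iio]
    refine and_congr_right fun hu => ?_
    obtain ⟨h1, h2⟩ := hu n le_rfl
    simp only [qPolyaState, h1, h2, ← hp]
    split_ifs with h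
    · simp [h]
    · simp [h, hk.ne']
  have hindep : iIndepFun (fun (i : ℕ) (u : ℕ → ℝ) => u i) P :=
    iIndepFun_infinitePi (P := fun _ : ℕ => ν) (X := fun _ x => x) fun _ => measurable_id
  have hdisj : Disjoint (Finset.range n) {n} := by simp
  have hind := hindep.indepFun_finset _ _ hdisj fun i => measurable_pi_apply i
  have hν : P.real ((fun (u : ℕ → ℝ) (i : ({n} : Finset ℕ)) => u i) ⁻¹'
        ((fun g => g ⟨n, Finset.mem_singleton_self n⟩) ⁻¹' Iio p)) = p := by
    have h1 : P.map (fun u : ℕ → ℝ => u n) = ν := Measure.infinitePi_map_eval (fun _ => ν) n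
    have h2 : (fun (u : ℕ → ℝ) (i : ({n} : Finset ℕ)) => u i) ⁻¹'
        ((fun g => g ⟨n, Finset.mem_singleton_self n⟩) ⁻¹' Iio p) =
        (fun u : ℕ → ℝ => u n) ⁻¹' Iio p := rfl
    rw [h2, measureReal_def, ← Measure.map_apply (measurable_pi_apply n) measurableSet_Iio, h1]
    have h3 : Iio p ∩ Icc 0 1 = Ico 0 p := by
      ext x; simp only [mem_inter_iff, mem_Iio, mem_Icc, mem_Ico]
      constructor
      · rintro ⟨h, h', -⟩; exact ⟨h', h⟩
      · rintro ⟨h, h'⟩; exact ⟨h', h, h'.le.trans hp1⟩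
    rw [Measure.restrict_apply measurableSet_Iio, h3, Real.volume_Ico, sub_zero,
      ENNReal.toReal_ofReal hp0]
  have key := hind.measure_inter_preimage_eq_mul _ _ (hext hH)
    ((measurable_pi_apply (⟨n, Finset.mem_singleton_self n⟩ : ({n} : Finset ℕ)))
      (measurableSet_Iio (a := p)))
  rw [hE]
  change P.real _ = p * P.real H
  rw [measureReal_def]
  conv_lhs => rw [hHS]
  rw [key, ENNReal.toReal_mul, ← hHS, ← measureReal_def, ← measureReal_def, hν, mul_comm]

/-- `X : [0, ∞) → ℝ` solves `X_0 = a`, `dX_t = k (1 - c ^ X_t) / (1 - c ^ (a + b + k t)) dt`.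
(Values of `X` at negative times play no role; the derivative at `0` is the right one.) -/
def IsQPolyaODESolution (c a b : ℝ) (k : ℕ) (X : ℝ → ℝ) : Prop :=
  X 0 = a ∧ ∀ t : ℝ, 0 ≤ t →
    HasDerivWithinAt X (k * ((1 - c ^ X t) / (1 - c ^ (a + b + k * t)))) (Ici 0) t

/-- The explicit deterministic limit. -/
noncomputable def qPolyaLimit (c a b : ℝ) (k : ℕ) (t : ℝ) : ℝ :=
  a - 1 / Real.log c *
    Real.log ((c ^ b - 1 + c ^ (-(k * t)) * (1 - c ^ (-a))) / (c ^ b - c ^ (-a)))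

/-! The proof rests on one quantity. For an urn with `w` white and `s` black balls, `(1 - q ^ (-w))
/ (1 - q ^ (-(w + s)))` is a martingale (`qPolyaMartingale_mean`). It lies in `[0, 1]`, and for `q =
c ^ (1 / m)` its jumps are `O(1 / m)`. Orthogonality of increments bounds its mean square deviation
after `[m t]` drawings by `O(m * (1 / m) ^ 2)`, which tends to zero
(`integral_sq_martingale_sub_le`, `tendsto_integral_sq_martingale_sub`).

The total number of balls is deterministic, so the martingale determines `c ^ (-A / m)`. By
Chebyshev, `A / m` at each fixed time converges in probability to the number `x` for which the
quotient `(1 - c ^ (-x)) / (1 - c ^ (-(a + b + k t)))` keeps its value at time zero. This `x` is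
`qPolyaLimit` (`rpow_neg_qPolyaLimit`), and the same quotient is a first integral of the
differential equation, which gives uniqueness.

Paths are monotone and the limit is continuous, so closeness at finitely many times forces uniform
closeness on `[0, T]` (`exists_finset_forall_abs_sub_lt`). Uniformly close paths are Skorokhod close
with the identity as time change, and convergence in probability to a constant gives convergence in
distribution. -/

/-! ### Convergence to a constant and the Skorokhod topology -/

/-- If `X m` is eventually in each open neighbourhood of the point `x` with probability tending to
one, then it converges in distribution to `x`. -/
lemma tendstoInDistribution_dirac_of_forall_isOpen {ι E : Type*} {l : Filter ι}
    [l.IsCountablyGenerated] [TopologicalSpace E] [MeasurableSpace E] [BorelSpace E]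
    {Ω : ι → Type*} [∀ i, MeasurableSpace (Ω i)] {P : (i : ι) → Measure (Ω i)}
    [∀ i, IsProbabilityMeasure (P i)] {X : (i : ι) → Ω i → E} (hX : ∀ i, AEMeasurable (X i) (P i))
    {x : E} (h : ∀ U, IsOpen U → x ∈ U → Tendsto (fun i => P i (X i ⁻¹' U)) l (𝓝 1)) :
    TendstoInDistribution X l (fun _ : Unit => x) P (Measure.dirac ()) where
  forall_aemeasurable := hX
  aemeasurable_limit := aemeasurable_const
  tendsto := by
    -- Portmanteau: for a Dirac limit, only open sets containing `x` impose a condition.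
    refine tendsto_of_forall_isOpen_le_liminf' fun U hU => ?_
    rcases l.eq_or_neBot with rfl | hl
    · simp
    simp only [ProbabilityMeasure.coe_mk, Measure.map_const, measure_univ, one_smul]
    by_cases hx : x ∈ U
    · have : Tendsto (fun i => (P i).map (X i) U) l (𝓝 1) :=
        (h U hU hx).congr fun i => (Measure.map_apply_of_aemeasurable (hX i) hU.measurableSet).symm
      rw [this.liminf_eq]
      exact prob_le_one
    · rw [Measure.dirac_apply' _ hU.measurableSet, indicator_of_notMem hx]
      exact zero_le

/-- On `[0, T]` the path depends on finitely many terms of the sequence, and in the product of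
discrete spaces nearby sequences agree on these. Continuity supplies Borel measurability of the
random path. -/
lemma continuous_rescaledPath (m : ℕ+) : Continuous (rescaledPath m) := by
  refine continuous_def.2 fun U hU => isOpen_iff_mem_nhds.2 fun x hx => ?_
  obtain ⟨T, ε, hε, h⟩ := hU _ hx
  have h1 : ∀ᶠ y in 𝓝 x, ∀ i ∈ Finset.range (⌊(m : ℝ≥0) * T⌋₊ + 1), y i = x i :=
    (Finset.eventually_all _).2 fun i _ =>
      ((continuous_apply i).tendsto x).eventually (p := fun z : ℕ => z = x i) (by simp)
  filter_upwards [h1] with y hy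
  refine h ⟨OrderIso.refl _, fun t ht => ?_⟩
  have h2 : y ⌊(m : ℝ≥0) * t⌋₊ = x ⌊(m : ℝ≥0) * t⌋₊ :=
    hy _ (Finset.mem_range.2 (Nat.lt_succ_iff.2 (Nat.floor_mono (by gcongr))))
  simp [rescaledPath, h2, hε]

lemma SkorokhodSpace.mem_basicNhd_of_forall_abs_lt {f g : SkorokhodSpace} {T : ℝ≥0} {ε : ℝ}
    (hε : 0 < ε) (h : ∀ t ≤ T, |g t - f t| < ε) : g ∈ basicNhd f T ε :=
  ⟨OrderIso.refl _, fun t ht => ⟨by simpa using hε, by simpa using h t ht⟩⟩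

lemma Continuous.isCadlag {f : ℝ≥0 → ℝ} (hf : Continuous f) : IsCadlag f := fun t =>
  ⟨hf.continuousWithinAt, f t, hf.continuousWithinAt⟩

/-! ### The differential equation and its explicit solution -/

section ODE

variable {c a b : ℝ} {k : ℕ}

lemma qPolyaLimit_numerator_pos (hc : 1 < c) (ha : 0 ≤ a) (hb : 0 ≤ b) (hab : ¬(a = 0 ∧ b = 0))
    (t : ℝ) : 0 < c ^ b - 1 + c ^ (-(k * t)) * (1 - c ^ (-a)) := by
  have hy : 0 < c ^ (-(k * t)) := Real.rpow_pos_of_pos (by linarith) _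
  rcases ha.eq_or_lt with rfl | ha
  · have : 1 < c ^ b := Real.one_lt_rpow hc (hb.lt_of_ne fun h => hab ⟨rfl, h.symm⟩)
    simpa using this
  · have h1 : 1 ≤ c ^ b := Real.one_le_rpow hc.le hb
    have h2 : c ^ (-a) < 1 := Real.rpow_lt_one_of_one_lt_of_neg hc (by linarith)
    have := mul_pos hy (sub_pos.2 h2)
    linarith

lemma qPolyaLimit_denominator_pos (hc : 1 < c) (ha : 0 ≤ a) (hb : 0 ≤ b)
    (hab : ¬(a = 0 ∧ b = 0)) : 0 < c ^ b - c ^ (-a) := by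
  have := qPolyaLimit_numerator_pos (k := 0) hc ha hb hab 0
  simp only [CharP.cast_eq_zero, zero_mul, neg_zero, Real.rpow_zero, one_mul] at this
  linarith

lemma add_pos_of_not_both_zero (ha : 0 ≤ a) (hb : 0 ≤ b) (hab : ¬(a = 0 ∧ b = 0)) :
    0 < a + b := by
  rcases ha.eq_or_lt with rfl | ha
  · simpa using hb.lt_of_ne fun h => hab ⟨rfl, h.symm⟩
  · linarith

/-- In the variable `c ^ (-x)` the logarithm disappears and the formula becomes the conservation law
shared by the differential equation and the urn martingale. -/
lemma rpow_neg_qPolyaLimit (hc : 1 < c) (ha : 0 ≤ a) (hb : 0 ≤ b) (hab : ¬(a = 0 ∧ b = 0))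
    (t : ℝ) : c ^ (-qPolyaLimit c a b k t) =
      1 - (1 - c ^ (-a)) / (1 - c ^ (-(a + b))) * (1 - c ^ (-(a + b + k * t))) := by
  have hc0 : 0 < c := by linarith
  have hn := qPolyaLimit_numerator_pos (k := k) hc ha hb hab t
  have hd := qPolyaLimit_denominator_pos hc ha hb hab
  have hL := Real.log_pos hc
  have h1 : c ^ (-(a + b)) < 1 :=
    Real.rpow_lt_one_of_one_lt_of_neg hc (by linarith [add_pos_of_not_both_zero ha hb hab])
  have h2 : -qPolyaLimit c a b k t = -a + 1 / Real.log c *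
      Real.log ((c ^ b - 1 + c ^ (-(k * t)) * (1 - c ^ (-a))) / (c ^ b - c ^ (-a))) := by
    unfold qPolyaLimit; ring
  have h3 : ∀ z : ℝ, 0 < z → c ^ (1 / Real.log c * Real.log z) = z := fun z hz => by
    rw [Real.rpow_def_of_pos hc0, ← mul_assoc, mul_one_div_cancel hL.ne', one_mul, Real.exp_log hz]
  rw [h2, Real.rpow_add hc0, h3 _ (div_pos hn hd), neg_add (a + b),
    Real.rpow_add hc0 (-(a + b)), neg_add a b, Real.rpow_add hc0 (-a)]
  rw [neg_add, Real.rpow_add hc0, Real.rpow_neg hc0.le b] at h1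
  rw [Real.rpow_neg hc0.le b]
  have hv : 0 < c ^ b := Real.rpow_pos_of_pos hc0 b
  have h4 : 1 - c ^ (-a) * (c ^ b)⁻¹ ≠ 0 := by linarith
  have h5 : c ^ b - c ^ (-a) ≠ 0 := hd.ne'
  field_simp
  ring

lemma qPolyaLimit_zero (hc : 1 < c) (ha : 0 ≤ a) (hb : 0 ≤ b) (hab : ¬(a = 0 ∧ b = 0)) :
    qPolyaLimit c a b k 0 = a := by
  have h : c ^ b - 1 + c ^ (-(k * (0 : ℝ))) * (1 - c ^ (-a)) = c ^ b - c ^ (-a) := by simp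
  rw [qPolyaLimit, h, div_self (qPolyaLimit_denominator_pos hc ha hb hab).ne']
  simp

lemma hasDerivAt_qPolyaLimit (hc : 1 < c) (ha : 0 ≤ a) (hb : 0 ≤ b) (hab : ¬(a = 0 ∧ b = 0))
    {t : ℝ} (ht : 0 ≤ t) : HasDerivAt (qPolyaLimit c a b k)
      (k * ((1 - c ^ qPolyaLimit c a b k t) / (1 - c ^ (a + b + k * t)))) t := by
  have hc0 : 0 < c := by linarith
  have hn := qPolyaLimit_numerator_pos (k := k) hc ha hb hab t
  have hd := qPolyaLimit_denominator_pos hc ha hb hab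
  have hL := Real.log_pos hc
  have hN : 0 < a + b + k * t := by
    have := add_pos_of_not_both_zero ha hb hab
    positivity
  have h1 : HasDerivAt (fun t : ℝ => c ^ (-(k * t))) (Real.log c * (-k) * c ^ (-(k * t))) t := by
    have := (((hasDerivAt_id t).const_mul (k : ℝ)).neg).const_rpow hc0
    simpa using this
  have h2 := ((((h1.mul_const (1 - c ^ (-a))).const_add (c ^ b - 1)).div_const
    (c ^ b - c ^ (-a))).log (div_pos hn hd).ne').const_mul (1 / Real.log c) |>.const_sub a
  refine h2.congr_deriv ?_
  have h3 : 1 < c ^ (a + b + k * t) := Real.one_lt_rpow hc hN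
  have h4 := rpow_neg_qPolyaLimit (k := k) hc ha hb hab t
  have h5 : c ^ (-(a + b)) < 1 :=
    Real.rpow_lt_one_of_one_lt_of_neg hc (by linarith [add_pos_of_not_both_zero ha hb hab])
  have h6 : c ^ qPolyaLimit c a b k t = (c ^ (-qPolyaLimit c a b k t))⁻¹ := by
    rw [Real.rpow_neg hc0.le, inv_inv]
  have h7 : 0 < c ^ (-qPolyaLimit c a b k t) := Real.rpow_pos_of_pos hc0 _
  have h8 : (1 - c ^ (-(a + b))) * c ^ (-qPolyaLimit c a b k t) =
      c ^ (-a) * (c ^ (-b) * (c ^ b - 1 + c ^ (-(k * t)) * (1 - c ^ (-a)))) := by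
    rw [h4, mul_sub, ← mul_assoc, mul_div_cancel₀ _ (by linarith)]
    have : c ^ (-b) * c ^ b = 1 := by rw [← Real.rpow_add hc0]; simp
    rw [neg_add, neg_add, Real.rpow_add hc0, Real.rpow_add hc0, neg_add, Real.rpow_add hc0]
    linear_combination -c ^ (-a) * this
  rw [h6]
  have h9 : c ^ (a + b + k * t) = (c ^ (-(a + b)) * c ^ (-(k * t)))⁻¹ := by
    rw [← Real.rpow_add hc0, ← Real.rpow_neg hc0.le]; congr 1; ring
  rw [h9] at h3 ⊢
  set Y := c ^ (-qPolyaLimit c a b k t)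
  set y := c ^ (-(k * t))
  set M := c ^ (-(a + b)) with hM
  rw [neg_add, Real.rpow_add hc0] at hM
  have hy : 0 < y := Real.rpow_pos_of_pos hc0 _
  have hMpos : 0 < M := Real.rpow_pos_of_pos hc0 _
  have h10 : 0 < 1 - M * y := by
    have := (one_lt_inv₀ (by positivity)).1 h3
    linarith
  have h11 : Y * (1 - M) = 1 - M - (1 - c ^ (-a)) * (1 - M * y) := by
    rw [h4, sub_mul, mul_right_comm, div_mul_cancel₀ _ (by linarith), neg_add (a + b),
      Real.rpow_add hc0]
    ring
  have h12 : 1 - (M * y)⁻¹ ≠ 0 := by linarith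
  rw [← mul_assoc (c ^ (-a)), ← hM] at h8
  set N := c ^ b - 1 + y * (1 - c ^ (-a))
  -- The left side, times `k`, is the derivative of the explicit formula. The right side is the
  -- vector field; `h8` now reads `(1 - M) * Y = M * N` and eliminates `N`.
  have h13 : y * (1 - c ^ (-a)) / N = (1 - Y⁻¹) / (1 - (M * y)⁻¹) := by
    have h14 : (1 - Y⁻¹) * N = N - (1 - M) / M := by
      field_simp
      linear_combination h8
    rw [div_eq_div_iff hn.ne' h12, h14]
    field_simp
    linear_combination h8 - h11
  rw [← h13, div_div_div_cancel_right₀ hd.ne']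
  field_simp

lemma isQPolyaODESolution_qPolyaLimit (hc : 1 < c) (ha : 0 ≤ a) (hb : 0 ≤ b)
    (hab : ¬(a = 0 ∧ b = 0)) : IsQPolyaODESolution c a b k (qPolyaLimit c a b k) :=
  ⟨qPolyaLimit_zero hc ha hb hab, fun _ ht =>
    (hasDerivAt_qPolyaLimit hc ha hb hab ht).hasDerivWithinAt⟩

/-- The equation is separable with first integral `(1 - c ^ (-X)) / (1 - c ^ (-(a + b + k s)))`. Its
derivative along any solution vanishes, so its initial value determines `X`; no Lipschitz estimate
is needed. -/
lemma IsQPolyaODESolution.eq_qPolyaLimit (hc : 1 < c) (ha : 0 ≤ a) (hb : 0 ≤ b)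
    (hab : ¬(a = 0 ∧ b = 0)) {X : ℝ → ℝ} (hX : IsQPolyaODESolution c a b k X) {t : ℝ}
    (ht : 0 ≤ t) : X t = qPolyaLimit c a b k t := by
  have hc0 : 0 < c := by linarith
  have hab0 := add_pos_of_not_both_zero ha hb hab
  have hD : ∀ s : ℝ, 0 ≤ s → c ^ (-(a + b + k * s)) < 1 := fun s hs =>
    Real.rpow_lt_one_of_one_lt_of_neg hc (by have := mul_nonneg k.cast_nonneg hs; linarith)
  have hderiv : ∀ s : ℝ, 0 ≤ s →
      HasDerivWithinAt (fun s => (1 - c ^ (-X s)) / (1 - c ^ (-(a + b + k * s)))) 0 (Ici 0) s := by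
    intro s hs
    have h1 := ((hX.2 s hs).neg.const_rpow hc0).const_sub 1
    have h2 : HasDerivWithinAt (fun s : ℝ => 1 - c ^ (-(a + b + k * s)))
        (-(Real.log c * (-k) * c ^ (-(a + b + k * s)))) (Ici 0) s := by
      have := ((((hasDerivWithinAt_id s (Ici 0)).const_mul (k : ℝ)).const_add
        (a + b)).neg.const_rpow hc0).const_sub 1
      simpa using this
    refine (h1.div h2 (by linarith [hD s hs])).congr_deriv ?_
    have h3 := hD s hs
    simp only [Pi.neg_apply]
    rw [Real.rpow_neg hc0.le] at h3 ⊢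
    rw [Real.rpow_neg hc0.le]
    have hu : 0 < c ^ X s := Real.rpow_pos_of_pos hc0 _
    have hv : 0 < c ^ (a + b + k * s) := Real.rpow_pos_of_pos hc0 _
    have hv1 := (inv_lt_one₀ hv).1 h3
    have h4 : 1 - c ^ (a + b + k * s) ≠ 0 := by linarith
    have h5 : c ^ (a + b + k * s) - 1 ≠ 0 := by linarith
    field_simp
    ring
  have hconst := constant_of_has_deriv_right_zero (a := 0) (b := t)
    (fun s hs => ((hderiv s hs.1).mono Icc_subset_Ici_self).continuousWithinAt)
    (fun s hs => (hderiv s hs.1).mono (Ici_subset_Ici.2 hs.1)) t ⟨ht, le_rfl⟩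
  simp only [hX.1, mul_zero, add_zero] at hconst
  have h1 : c ^ (-X t) = c ^ (-qPolyaLimit c a b k t) := by
    rw [rpow_neg_qPolyaLimit hc ha hb hab, ← hconst,
      div_mul_cancel₀ _ (by linarith [hD t ht])]
    ring
  exact neg_injective ((Real.strictMono_rpow_of_base_gt_one hc).injective h1)

end ODE

/-! ### The martingale of the urn: one-step algebra -/

/-- The quantity `(1 - q ^ (-w)) / (1 - q ^ (-(w + b)))`, which is a martingale when evaluated
along the composition of a `q`-Pólya urn. -/
noncomputable def qPolyaMartingale (q : ℝ) (z : ℕ × ℕ) : ℝ :=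
  (1 - q ^ (-(z.1 : ℝ))) / (1 - q ^ (-((z.1 : ℝ) + z.2)))

/-- The probability of drawing white from a `q`-Pólya urn of composition `z`. -/
noncomputable def qPolyaProb (q : ℝ) (z : ℕ × ℕ) : ℝ :=
  qNumber q z.1 / qNumber q (z.1 + z.2)

lemma qPolyaProb_nonneg {q : ℝ} (hq : 0 < q) (z : ℕ × ℕ) : 0 ≤ qPolyaProb q z :=
  div_nonneg (qNumber_nonneg hq (by positivity)) (qNumber_nonneg hq (by positivity))

lemma qPolyaProb_le_one {q : ℝ} (hq : 0 < q) (z : ℕ × ℕ) : qPolyaProb q z ≤ 1 :=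
  div_le_one_of_le₀ (qNumber_mono hq (by simp)) (qNumber_nonneg hq (by positivity))

/-- This bound and the next include the empty composition, where `0 / 0 = 0`; boundedness at every
`z` makes all integrals below finite. -/
lemma qPolyaMartingale_nonneg {q : ℝ} (hq : 1 < q) (z : ℕ × ℕ) : 0 ≤ qPolyaMartingale q z :=
  div_nonneg (sub_nonneg.2 (Real.rpow_le_one_of_one_le_of_nonpos hq.le (by simp)))
    (sub_nonneg.2 (Real.rpow_le_one_of_one_le_of_nonpos hq.le (by linarith [
      (Nat.cast_nonneg z.1 : (0 : ℝ) ≤ z.1), (Nat.cast_nonneg z.2 : (0 : ℝ) ≤ z.2)])))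

lemma qPolyaMartingale_le_one {q : ℝ} (hq : 1 < q) (z : ℕ × ℕ) : qPolyaMartingale q z ≤ 1 :=
  div_le_one_of_le₀ (sub_le_sub_left (Real.rpow_le_rpow_of_exponent_le hq.le (by simp)) 1)
    (sub_nonneg.2 (Real.rpow_le_one_of_one_le_of_nonpos hq.le (by linarith [
      (Nat.cast_nonneg z.1 : (0 : ℝ) ≤ z.1), (Nat.cast_nonneg z.2 : (0 : ℝ) ≤ z.2)])))

/-- Both outcomes have the same total, hence the same denominator. -/
lemma qPolyaMartingale_white_sub_black {q : ℝ} (k : ℕ) (z : ℕ × ℕ) (hq : 1 < q) :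
    qPolyaMartingale q (z.1 + k, z.2) - qPolyaMartingale q (z.1, z.2 + k) =
      q ^ (-(z.1 : ℝ)) * (1 - q ^ (-(k : ℝ))) / (1 - q ^ (-((z.1 : ℝ) + z.2 + k))) := by
  have h1 : ((z.1 + k : ℕ) : ℝ) + z.2 = z.1 + z.2 + k := by push_cast; ring
  have h2 : (z.1 : ℝ) + (z.2 + k : ℕ) = z.1 + z.2 + k := by push_cast; ring
  simp only [qPolyaMartingale]
  rw [h1, h2, ← sub_div, Nat.cast_add, neg_add, Real.rpow_add (by linarith)]
  ring

/-- With `u = q ^ w`, `v = q ^ (w + s)`, `y = q ^ k`, the white probability `(u - 1) / (v - 1)`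
times `u⁻¹` is `(1 - u⁻¹) / (v - 1)`. So `1 - u⁻¹` factors out of the mean, and the remaining factor
is `v / (v - 1)`. A nonempty urn ensures `v ≠ 1`. -/
lemma qPolyaMartingale_mean {q : ℝ} (hq : 1 < q) {k : ℕ} {z : ℕ × ℕ} (hz : 0 < z.1 + z.2) :
    qPolyaProb q z * qPolyaMartingale q (z.1 + k, z.2) +
      (1 - qPolyaProb q z) * qPolyaMartingale q (z.1, z.2 + k) = qPolyaMartingale q z := by
  have hq0 : 0 < q := by linarith
  have h0 : qPolyaMartingale q (z.1 + k, z.2) = _ :=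
    sub_eq_iff_eq_add.1 (qPolyaMartingale_white_sub_black k z hq)
  have hN : (0 : ℝ) < z.1 + z.2 := by exact_mod_cast hz
  have h2 : (z.1 : ℝ) + (z.2 + k : ℕ) = z.1 + z.2 + k := by push_cast; ring
  rw [h0]
  simp only [qPolyaMartingale, qPolyaProb, qNumber]
  rw [h2, div_div_div_cancel_right₀ (by linarith)]
  have hu : 0 < q ^ (z.1 : ℝ) := Real.rpow_pos_of_pos hq0 _
  have hv : 1 < q ^ ((z.1 : ℝ) + z.2) := Real.one_lt_rpow hq hN
  have hy : 1 ≤ q ^ (k : ℝ) := Real.one_le_rpow hq.le (by positivity)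
  rw [Real.rpow_neg hq0.le, Real.rpow_neg hq0.le, Real.rpow_neg hq0.le, Real.rpow_neg hq0.le,
    Real.rpow_add hq0 _ (k : ℝ)]
  set u := q ^ (z.1 : ℝ)
  set v := q ^ ((z.1 : ℝ) + z.2)
  set y := q ^ (k : ℝ)
  have hvy : 1 < v * y := by nlinarith
  have h3 : v - 1 ≠ 0 := by linarith
  have h4 : v * y - 1 ≠ 0 := by linarith
  field_simp
  ring

lemma abs_qPolyaMartingale_white_sub_black_le {q : ℝ} (hq : 1 < q) {k N : ℕ} {z : ℕ × ℕ}
    (hN : 0 < N) (hz : N ≤ z.1 + z.2) :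
    |qPolyaMartingale q (z.1 + k, z.2) - qPolyaMartingale q (z.1, z.2 + k)| ≤
      (1 - q ^ (-(k : ℝ))) / (1 - q ^ (-(N : ℝ))) := by
  have hq0 : 0 < q := by linarith
  have hN' : (0 : ℝ) < N := by exact_mod_cast hN
  have hz' : (N : ℝ) ≤ z.1 + z.2 := by exact_mod_cast hz
  have hk : (0 : ℝ) ≤ k := by positivity
  have h1 : q ^ (-(N : ℝ)) < 1 := Real.rpow_lt_one_of_one_lt_of_neg hq (by linarith)
  have h2 : q ^ (-((z.1 : ℝ) + z.2 + k)) ≤ q ^ (-(N : ℝ)) :=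
    Real.rpow_le_rpow_of_exponent_le hq.le (by linarith)
  have h3 : q ^ (-(k : ℝ)) ≤ 1 := Real.rpow_le_one_of_one_le_of_nonpos hq.le (by linarith)
  have h4 : q ^ (-(z.1 : ℝ)) ≤ 1 := Real.rpow_le_one_of_one_le_of_nonpos hq.le (by simp)
  have h5 : 0 < q ^ (-(z.1 : ℝ)) := Real.rpow_pos_of_pos hq0 _
  rw [qPolyaMartingale_white_sub_black k z hq, abs_of_nonneg
    (div_nonneg (mul_nonneg h5.le (by linarith)) (by linarith))]
  exact div_le_div₀ (by linarith) (mul_le_of_le_one_left (by linarith) h4) (by linarith)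
    (by linarith)

/-! ### Second moment of the martingale along the urn -/

namespace IsQPolyaUrn

variable {Ω : Type*} [MeasurableSpace Ω] {P : Measure Ω} {q : ℝ} {k r s : ℕ} {A B : ℕ → Ω → ℕ}

lemma measurable_state (h : IsQPolyaUrn P q k r s A B) (n : ℕ) :
    Measurable (fun ω => (A n ω, B n ω)) :=
  (h.measurable_white n).prodMk (h.measurable_black n)

lemma measurableSet_white (h : IsQPolyaUrn P q k r s A B) (n : ℕ) :
    MeasurableSet {ω | A (n + 1) ω = A n ω + k ∧ B (n + 1) ω = B n ω} :=
  (measurableSet_eq_fun (h.measurable_white _) ((h.measurable_white n).add_const k)).inter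
    (measurableSet_eq_fun (h.measurable_black _) (h.measurable_black n))

lemma ae_add_eq (h : IsQPolyaUrn P q k r s A B) :
    ∀ᵐ ω ∂P, ∀ n, A n ω + B n ω = r + s + k * n := by
  filter_upwards [h.init, ae_all_iff.2 h.step] with ω h0 h1 n
  induction n with
  | zero => simp [h0.1, h0.2]
  | succ n ih => rcases h1 n with ⟨h2, h3⟩ | ⟨h2, h3⟩ <;> rw [h2, h3, mul_add] <;> omega

lemma ae_monotone (h : IsQPolyaUrn P q k r s A B) : ∀ᵐ ω ∂P, Monotone fun n => A n ω := by
  filter_upwards [ae_all_iff.2 h.step] with ω h1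
  exact monotone_nat_of_le_succ fun n => by rcases h1 n with h2 | h2 <;> omega

variable [IsProbabilityMeasure P]

/-- The Markov form of the drawing rule. -/
lemma map_restrict_white (h : IsQPolyaUrn P q k r s A B) (hq : 0 < q) (n : ℕ) :
    (P.restrict {ω | A (n + 1) ω = A n ω + k ∧ B (n + 1) ω = B n ω}).map
        (fun ω => (A n ω, B n ω)) =
      (P.map (fun ω => (A n ω, B n ω))).withDensity
        (fun z => ENNReal.ofReal (qPolyaProb q z)) := by
  set W := {ω | A (n + 1) ω = A n ω + k ∧ B (n + 1) ω = B n ω} with hW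
  have hWm : MeasurableSet W := h.measurableSet_white n
  refine Measure.ext_of_singleton fun z => ?_
  rw [Measure.map_apply (h.measurable_state n) (measurableSet_singleton z),
    withDensity_apply _ (measurableSet_singleton z), Measure.restrict_singleton,
    lintegral_smul_measure, lintegral_dirac, Measure.map_apply (h.measurable_state n)
      (measurableSet_singleton z), smul_eq_mul]
  set V := (fun ω => (A n ω, B n ω)) ⁻¹' {z} with hV
  have hVm : MeasurableSet V := h.measurable_state n (measurableSet_singleton z)
  let H : Ω → Fin (n + 1) → ℕ × ℕ := fun ω i => (A i ω, B i ω)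
  have hH : Measurable H := measurable_pi_lambda _ fun i => h.measurable_state i
  -- The drawing rule conditions on whole histories. Histories up to time `n` form a countable set,
  -- so the identity is checked on each one; taking total mass then sums over all histories ending
  -- in `z`.
  have key : (P.restrict (W ∩ V)).map H =
      ENNReal.ofReal (qPolyaProb q z) • (P.restrict V).map H := by
    refine Measure.ext_of_singleton fun x => ?_
    have hx := hH (measurableSet_singleton x)
    rw [Measure.smul_apply, Measure.map_apply hH (measurableSet_singleton x),
      Measure.map_apply hH (measurableSet_singleton x), Measure.restrict_apply hx,
      Measure.restrict_apply hx, smul_eq_mul]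
    by_cases hxz : x (Fin.last n) = z
    · let y : ℕ → ℕ × ℕ := fun i => if hi : i < n + 1 then x ⟨i, hi⟩ else 0
      have hyn : y n = z := by simp only [y, lt_add_iff_pos_right, zero_lt_one, dite_true]; exact hxz
      have hy : ∀ ω, (∀ i ≤ n, A i ω = (y i).1 ∧ B i ω = (y i).2) ↔ H ω = x := by
        intro ω
        simp only [funext_iff, H, Fin.forall_iff, Nat.lt_succ_iff, Prod.ext_iff]
        refine forall₂_congr fun i hi => ?_
        simp [y, hi]
      have hHV : ∀ ω, H ω = x → A n ω = z.1 ∧ B n ω = z.2 := fun ω hω => by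
        simpa [hyn] using (hy ω).2 hω n le_rfl
      have hp := h.prob_white n (fun i => (y i).1) (fun i => (y i).2)
      have e1 : {ω | (∀ i ≤ n, A i ω = (y i).1 ∧ B i ω = (y i).2) ∧
          A (n + 1) ω = (y n).1 + k ∧ B (n + 1) ω = (y n).2} = H ⁻¹' {x} ∩ (W ∩ V) := by
        ext ω
        simp only [Set.mem_ofPred_eq, hy, hyn, mem_inter_iff, mem_preimage, mem_singleton_iff, hW,
          hV, Prod.ext_iff]
        constructor
        · rintro ⟨h1, h2⟩
          have := hHV ω h1
          simp_all
        · rintro ⟨h1, h2, h3, h4⟩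
          simp_all
      have e2 : {ω | ∀ i ≤ n, A i ω = (y i).1 ∧ B i ω = (y i).2} = H ⁻¹' {x} ∩ V := by
        ext ω
        simp only [Set.mem_ofPred_eq, hy, mem_inter_iff, mem_preimage, mem_singleton_iff, hV,
          Prod.ext_iff]
        exact ⟨fun h1 => ⟨h1, hHV ω h1⟩, And.left⟩
      rw [e1, e2, hyn] at hp
      change _ = qPolyaProb q z * _ at hp
      rw [← ofReal_measureReal, hp, ENNReal.ofReal_mul (qPolyaProb_nonneg hq z), ofReal_measureReal]
    · have : H ⁻¹' {x} ∩ V = ∅ := by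
        ext ω
        simp only [mem_inter_iff, mem_preimage, mem_singleton_iff, hV, mem_empty_iff_false,
          iff_false, not_and]
        rintro rfl h2
        exact hxz h2
      rw [inter_comm W, ← inter_assoc, this]
      simp
  have := congrArg (fun μ => μ univ) key
  simp only [Measure.smul_apply, Measure.map_apply hH MeasurableSet.univ, preimage_univ,
    Measure.restrict_apply_univ, smul_eq_mul] at this
  rw [Measure.restrict_apply hVm, inter_comm, this, mul_comm]

lemma integral_succ (h : IsQPolyaUrn P q k r s A B) (hq : 0 < q) (n : ℕ) {φ : ℕ × ℕ → ℝ} {C : ℝ}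
    (hφ : ∀ z, |φ z| ≤ C) :
    ∫ ω, φ (A (n + 1) ω, B (n + 1) ω) ∂P =
      ∫ ω, (qPolyaProb q (A n ω, B n ω) * φ (A n ω + k, B n ω) +
        (1 - qPolyaProb q (A n ω, B n ω)) * φ (A n ω, B n ω + k)) ∂P := by
  set W := {ω | A (n + 1) ω = A n ω + k ∧ B (n + 1) ω = B n ω} with hW
  have hWm : MeasurableSet W := h.measurableSet_white n
  let ψ : ℕ × ℕ → ℝ := fun z => φ (z.1 + k, z.2) - φ (z.1, z.2 + k)
  have hZ := h.measurable_state n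
  have hint : ∀ (f : ℕ × ℕ → ℝ) (D : ℝ), (∀ z, |f z| ≤ D) →
      Integrable (fun ω => f (A n ω, B n ω)) P := fun f D hf =>
    Integrable.of_bound ((measurable_of_countable f).comp hZ).aestronglyMeasurable D
      (Eventually.of_forall fun ω => hf _)
  have hψ : ∀ z, |ψ z| ≤ C + C := fun z =>
    (abs_sub _ _).trans (add_le_add (hφ _) (hφ _))
  have hφi := hint (fun z => φ (z.1, z.2 + k)) C fun z => hφ _
  have hψi := hint ψ _ hψ
  have hpψ := hint (fun z => qPolyaProb q z * ψ z) (C + C) fun z => by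
    rw [abs_mul, abs_of_nonneg (qPolyaProb_nonneg hq z)]
    exact (mul_le_of_le_one_left (abs_nonneg _) (qPolyaProb_le_one hq z)).trans (hψ z)
  -- The black outcome is the baseline, corrected by `ψ` on the event of drawing white.
  have h1 : (fun ω => φ (A (n + 1) ω, B (n + 1) ω)) =ᵐ[P]
      fun ω => φ (A n ω, B n ω + k) + W.indicator (fun ω => ψ (A n ω, B n ω)) ω := by
    filter_upwards [h.step n] with ω hω
    by_cases hω' : ω ∈ W
    · rw [indicator_of_mem hω', hω'.1, hω'.2]
      simp [ψ]
    · rw [indicator_of_notMem hω', (hω.resolve_left hω').1, (hω.resolve_left hω').2, add_zero]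
  have h2 : ∫ ω in W, ψ (A n ω, B n ω) ∂P =
      ∫ ω, qPolyaProb q (A n ω, B n ω) * ψ (A n ω, B n ω) ∂P := by
    have hψm : ∀ μ : Measure (ℕ × ℕ), AEStronglyMeasurable ψ μ := fun μ =>
      (measurable_of_countable ψ).aestronglyMeasurable
    rw [← integral_map (φ := fun ω => (A n ω, B n ω)) hZ.aemeasurable (hψm _),
      h.map_restrict_white hq n, integral_withDensity_eq_integral_toReal_smul
        (measurable_of_countable _) (by simp), integral_map hZ.aemeasurable
        (measurable_of_countable _).aestronglyMeasurable]
    simp [ENNReal.toReal_ofReal (qPolyaProb_nonneg hq _)]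
  rw [integral_congr_ae h1, integral_add hφi (hψi.indicator hWm), integral_indicator hWm, h2,
    ← integral_add hφi hpψ]
  refine integral_congr_ae (Eventually.of_forall fun ω => ?_)
  simp only [ψ]
  ring

/-- Given the present, the martingale takes values `x` and `y` with probabilities `p` and `1 - p`.
Its mean square distance to `μ` exceeds the present squared distance by the variance `p * (1 - p) *
(x - y) ^ 2`, at most `δ ^ 2`. Totals never fall below the initial one, so one `δ` serves every
step. -/
lemma integral_sq_martingale_sub_le (h : IsQPolyaUrn P q k r s A B) (hq : 1 < q)
    (hrs : 0 < r + s) (n : ℕ) :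
    ∫ ω, (qPolyaMartingale q (A n ω, B n ω) - qPolyaMartingale q (r, s)) ^ 2 ∂P ≤
      n * ((1 - q ^ (-(k : ℝ))) / (1 - q ^ (-((r + s : ℕ) : ℝ)))) ^ 2 := by
  have hq0 : 0 < q := by linarith
  set μ := qPolyaMartingale q (r, s) with hμ
  set δ := (1 - q ^ (-(k : ℝ))) / (1 - q ^ (-((r + s : ℕ) : ℝ)))
  have hM0 := qPolyaMartingale_nonneg hq
  have hM1 := qPolyaMartingale_le_one hq
  have hb : ∀ z, |(qPolyaMartingale q z - μ) ^ 2| ≤ 1 := fun z => by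
    rw [abs_pow, sq_le_one_iff_abs_le_one, abs_abs]
    exact abs_le.2 ⟨by linarith [hM0 z, hM1 (r, s)], by linarith [hM1 z, hM0 (r, s)]⟩
  induction n with
  | zero =>
    refine (integral_eq_zero_of_ae ?_).trans_le (by simp)
    filter_upwards [h.init] with ω hω
    simp [hω.1, hω.2, hμ]
  | succ n ih =>
    have hint : Integrable (fun ω => (qPolyaMartingale q (A n ω, B n ω) - μ) ^ 2) P :=
      Integrable.of_bound ((measurable_of_countable
        (fun z => (qPolyaMartingale q z - μ) ^ 2)).comp (h.measurable_state n)).aestronglyMeasurable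
        1 (Eventually.of_forall fun ω => hb _)
    rw [h.integral_succ hq0 n hb]
    calc _ ≤ ∫ ω, ((qPolyaMartingale q (A n ω, B n ω) - μ) ^ 2 + δ ^ 2) ∂P := by
          refine integral_mono_of_nonneg (Eventually.of_forall fun ω => ?_)
            (hint.add (integrable_const _)) ?_
          · exact add_nonneg (mul_nonneg (qPolyaProb_nonneg hq0 _) (sq_nonneg _))
              (mul_nonneg (sub_nonneg.2 (qPolyaProb_le_one hq0 _)) (sq_nonneg _))
          · filter_upwards [h.ae_add_eq] with ω hω
            have hN : r + s ≤ A n ω + B n ω := by rw [hω n]; omega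
            have hmean := qPolyaMartingale_mean hq (k := k) (z := (A n ω, B n ω))
              (hrs.trans_le hN)
            have hd := abs_qPolyaMartingale_white_sub_black_le hq (k := k) (z := (A n ω, B n ω))
              hrs hN
            have hd2 := sq_le_sq' (abs_le.1 hd).1 (abs_le.1 hd).2
            have hp0 := qPolyaProb_nonneg hq0 (A n ω, B n ω)
            have hp1 := qPolyaProb_le_one hq0 (A n ω, B n ω)
            dsimp only at hmean hd2 ⊢
            set p := qPolyaProb q (A n ω, B n ω)
            set x := qPolyaMartingale q (A n ω + k, B n ω)
            set y := qPolyaMartingale q (A n ω, B n ω + k)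
            rw [← hmean]
            have hpp : p * (1 - p) ≤ 1 := by nlinarith
            have : p * (1 - p) * (x - y) ^ 2 ≤ 1 * δ ^ 2 :=
              mul_le_mul hpp hd2 (sq_nonneg _) zero_le_one
            linear_combination this
      _ = ∫ ω, (qPolyaMartingale q (A n ω, B n ω) - μ) ^ 2 ∂P + δ ^ 2 := by
          rw [integral_add hint (integrable_const _)]; simp
      _ ≤ _ := by push_cast; linarith

end IsQPolyaUrn

/-! ### From finitely many times to compact intervals -/

/-- A monotone `g` is squeezed between its values at neighbouring grid points. One half of `ε` pays
for the error there, the other for the oscillation of `f` over one mesh. -/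
lemma exists_finset_forall_abs_sub_lt {f : ℝ≥0 → ℝ} (hf : Continuous f) (T : ℝ≥0) {ε : ℝ}
    (hε : 0 < ε) : ∃ I : Finset ℝ≥0, ∀ g : ℝ≥0 → ℝ, Monotone g →
      (∀ t ∈ I, |g t - f t| < ε / 2) → ∀ t ≤ T, |g t - f t| < ε := by
  have huc := (isCompact_Icc (a := (0 : ℝ≥0)) (b := T + 1)).uniformContinuousOn_of_continuous
    hf.continuousOn
  obtain ⟨δ, hδ, hδf⟩ := Metric.uniformContinuousOn_iff.1 huc (ε / 2) (by positivity)
  lift δ to ℝ≥0 using hδ.le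
  have hδ : 0 < δ := by exact_mod_cast hδ
  -- The mesh is below `δ`, and at most `1` so that the grid point following `t ≤ T` stays in `[0, T
  -- + 1]`.
  set h : ℝ≥0 := min (δ / 2) 1 with hh
  have hpos : 0 < h := lt_min (half_pos hδ) one_pos
  have hhδ : h < δ := (min_le_left _ _).trans_lt (half_lt_self hδ)
  -- The `+ 2` includes the right neighbour of the last cell meeting `[0, T]`.
  refine ⟨(Finset.range (⌊T / h⌋₊ + 2)).image fun i : ℕ => (i : ℝ≥0) * h, fun g hg hI t ht => ?_⟩
  set i := ⌊t / h⌋₊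
  have hi : i ≤ ⌊T / h⌋₊ := Nat.floor_mono (by gcongr)
  have hmem : ∀ j < ⌊T / h⌋₊ + 2, |g (j * h) - f (j * h)| < ε / 2 := fun j hj =>
    hI _ (Finset.mem_image.2 ⟨j, Finset.mem_range.2 hj, rfl⟩)
  have h1 : (i : ℝ≥0) * h ≤ t := (le_div_iff₀ hpos).1 (Nat.floor_le zero_le)
  have h2 : t ≤ (i + 1 : ℕ) * h :=
    ((div_lt_iff₀ hpos).1 (by push_cast; exact Nat.lt_floor_add_one _)).le
  have h3 : ((i + 1 : ℕ) : ℝ≥0) * h = i * h + h := by push_cast; ring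
  have hT : t ∈ Icc (0 : ℝ≥0) (T + 1) := ⟨zero_le, ht.trans (by simp)⟩
  have hdist : ∀ s : ℝ≥0, s ≤ T + 1 → (s : ℝ) ≤ t + h → (t : ℝ) ≤ s + h → |f t - f s| < ε / 2 :=
    fun s hs h4 h5 => by
      have h6 : (h : ℝ) < δ := by exact_mod_cast hhδ
      refine hδf t hT s ⟨zero_le, hs⟩ ?_
      rw [NNReal.dist_eq, abs_lt]
      constructor <;> linarith
  have h1' : ((i : ℝ≥0) * h : ℝ) ≤ t := by exact_mod_cast h1
  have h2' : (t : ℝ) ≤ (i : ℝ≥0) * h + h := by rw [h3] at h2; exact_mod_cast h2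
  have hlow := hdist _ (h1.trans hT.2) (by push_cast at h1' ⊢; linarith [h.coe_nonneg])
    (by push_cast at h2' ⊢; linarith)
  have hup := hdist ((i + 1 : ℕ) * h)
    (by rw [h3]; exact add_le_add (h1.trans ht) (min_le_right _ _))
    (by rw [h3]; push_cast at h1' ⊢; linarith)
    (by rw [h3]; push_cast at h2' ⊢; linarith [h.coe_nonneg])
  have glow := hmem i (by omega)
  have gup := hmem (i + 1) (by omega)
  have m1 := hg h1
  have m2 := hg h2
  rw [abs_lt] at *
  constructor <;> linarith

/-- Quantitative injectivity of `x ↦ c ^ (-x)`, which transfers concentration of the martingale to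
`A / m`. Of the two directions, increasing `x` gives the smaller gap, since `c ^ ε + c ^ (-ε) ≥ 2`.
-/
lemma le_abs_rpow_neg_sub {c x y ε : ℝ} (hc : 1 < c) (hε : ε ≤ |x - y|) :
    c ^ (-y) * (1 - c ^ (-ε)) ≤ |c ^ (-x) - c ^ (-y)| := by
  have hc0 : 0 < c := by linarith
  have hy : 0 < c ^ (-y) := Real.rpow_pos_of_pos hc0 _
  rcases le_abs.1 hε with h | h
  · have : c ^ (-x) ≤ c ^ (-y) * c ^ (-ε) := by
      rw [← Real.rpow_add hc0]
      exact Real.rpow_le_rpow_of_exponent_le hc.le (by linarith)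
    rw [abs_sub_comm]
    exact le_trans (by linarith) (le_abs_self _)
  · have h1 : c ^ (-y) * c ^ ε ≤ c ^ (-x) := by
      rw [← Real.rpow_add hc0]
      exact Real.rpow_le_rpow_of_exponent_le hc.le (by linarith)
    have h2 : 1 - c ^ (-ε) ≤ c ^ ε - 1 := by
      have h3 : c ^ (-ε) * c ^ ε = 1 := by rw [← Real.rpow_add hc0]; simp
      nlinarith [sq_nonneg (c ^ ε - c ^ (-ε)), Real.rpow_pos_of_pos hc0 ε,
        Real.rpow_pos_of_pos hc0 (-ε)]
    have := mul_le_mul_of_nonneg_left h2 hy.le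
    exact le_trans (by linarith) (le_abs_self _)

lemma rpow_one_div_rpow_neg {c : ℝ} (hc : 0 ≤ c) (m : ℕ+) (x : ℝ) :
    (c ^ (1 / (m : ℝ))) ^ (-x) = c ^ (-(x / m)) := by
  rw [← Real.rpow_mul hc]
  congr 1
  ring

lemma continuous_qPolyaLimit {c a b : ℝ} (hc : 1 < c) (ha : 0 ≤ a) (hb : 0 ≤ b)
    (hab : ¬(a = 0 ∧ b = 0)) (k : ℕ) : Continuous (qPolyaLimit c a b k) := by
  have h1 : Continuous fun t : ℝ => c ^ (-(k * t)) :=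
    Real.continuous_const_rpow (by linarith) |>.comp (by fun_prop)
  unfold qPolyaLimit
  refine continuous_const.sub (continuous_const.mul (Continuous.log (by fun_prop) fun t => ?_))
  exact (div_pos (qPolyaLimit_numerator_pos hc ha hb hab t)
    (qPolyaLimit_denominator_pos hc ha hb hab)).ne'

lemma tendsto_pnat_cast_atTop : Tendsto (fun m : ℕ+ => (m : ℝ)) atTop atTop :=
  tendsto_natCast_atTop_atTop.comp tendsto_PNat_val_atTop_atTop

lemma tendsto_floor_mul_div_pnat (t : ℝ≥0) :
    Tendsto (fun m : ℕ+ => (⌊(m : ℝ≥0) * t⌋₊ : ℝ) / m) atTop (𝓝 t) := by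
  refine ((tendsto_nat_floor_mul_div_atTop t.coe_nonneg).comp tendsto_pnat_cast_atTop).congr
    fun m => ?_
  have h : (t : ℝ) * (m : ℝ) = (((m : ℝ≥0) * t : ℝ≥0) : ℝ) := by push_cast; ring
  simp only [Function.comp_apply]
  rw [h]
  congr 2

/-! ### The limit at a fixed time -/

section

variable {c a b : ℝ} {k : ℕ} {A₀ B₀ : ℕ+ → ℕ}
  {Ω : ℕ+ → Type*} [∀ m, MeasurableSpace (Ω m)]
  {P : (m : ℕ+) → Measure (Ω m)} [∀ m, IsProbabilityMeasure (P m)]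
  {A B : (m : ℕ+) → ℕ → Ω m → ℕ}

lemma tendsto_integral_sq_martingale_sub (hc : 1 < c) (hab : 0 < a + b)
    (hpos : ∀ m, 0 < A₀ m + B₀ m)
    (hA₀ : Tendsto (fun m : ℕ+ => (A₀ m : ℝ) / m) atTop (𝓝 a))
    (hB₀ : Tendsto (fun m : ℕ+ => (B₀ m : ℝ) / m) atTop (𝓝 b))
    (hurn : ∀ m : ℕ+, IsQPolyaUrn (P m) (c ^ (1 / (m : ℝ))) k (A₀ m) (B₀ m) (A m) (B m))
    (t : ℝ≥0) :
    Tendsto (fun m : ℕ+ => ∫ ω, (qPolyaMartingale (c ^ (1 / (m : ℝ)))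
      (A m ⌊(m : ℝ≥0) * t⌋₊ ω, B m ⌊(m : ℝ≥0) * t⌋₊ ω) -
        qPolyaMartingale (c ^ (1 / (m : ℝ))) (A₀ m, B₀ m)) ^ 2 ∂P m) atTop (𝓝 0) := by
  have hc0 : 0 < c := by linarith
  have hcont : Continuous fun x : ℝ => c ^ (-x) :=
    (Real.continuous_const_rpow hc0.ne').comp continuous_neg
  have hD : 1 - c ^ (-(a + b)) ≠ 0 :=
    (sub_pos.2 (Real.rpow_lt_one_of_one_lt_of_neg hc (by linarith))).ne'
  have hm := tendsto_pnat_cast_atTop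
  -- The variance bound in scaled form: `[m t]` steps of squared size `O(m⁻²)`, leaving a factor
  -- `m⁻¹`.
  have hlim : Tendsto (fun m : ℕ+ => (⌊(m : ℝ≥0) * t⌋₊ : ℝ) / m *
      ((Real.log c * k / (1 - c ^ (-((A₀ m : ℝ) / m + (B₀ m : ℝ) / m)))) ^ 2) * (m : ℝ)⁻¹) atTop
      (𝓝 (t * ((Real.log c * k / (1 - c ^ (-(a + b)))) ^ 2) * 0)) :=
    (((tendsto_floor_mul_div_pnat t).mul ((tendsto_const_nhds.div (tendsto_const_nhds.sub
      ((hcont.tendsto _).comp (hA₀.add hB₀))) hD).pow 2))).mul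
      (tendsto_inv_atTop_zero.comp hm)
  rw [mul_zero] at hlim
  refine squeeze_zero (fun m => integral_nonneg fun ω => sq_nonneg _) (fun m => ?_) hlim
  have hm0 : (0 : ℝ) < m := by exact_mod_cast m.pos
  refine ((hurn m).integral_sq_martingale_sub_le (Real.one_lt_rpow hc (by positivity)) (hpos m)
    _).trans ?_
  have hN : (0 : ℝ) < (A₀ m : ℝ) / m + (B₀ m : ℝ) / m := by
    rw [← add_div]
    exact div_pos (by exact_mod_cast hpos m) hm0
  have h1 : 0 < 1 - c ^ (-((A₀ m : ℝ) / m + (B₀ m : ℝ) / m)) :=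
    sub_pos.2 (Real.rpow_lt_one_of_one_lt_of_neg hc (by linarith))
  -- This is `1 - exp (-x) ≤ x` with `x = log c * k / m`.
  have h2 : 1 - c ^ (-((k : ℝ) / m)) ≤ Real.log c * k / m := by
    rw [Real.rpow_def_of_pos hc0]
    have := Real.one_sub_le_exp_neg (Real.log c * k / m)
    have e : Real.log c * -((k : ℝ) / m) = -(Real.log c * k / m) := by ring
    rw [e]
    linarith
  have h3 : 0 ≤ 1 - c ^ (-((k : ℝ) / m)) :=
    sub_nonneg.2 (Real.rpow_le_one_of_one_le_of_nonpos hc.le (by simp; positivity))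
  rw [rpow_one_div_rpow_neg hc0.le, rpow_one_div_rpow_neg hc0.le, Nat.cast_add, add_div]
  set d := 1 - c ^ (-((A₀ m : ℝ) / m + (B₀ m : ℝ) / m))
  calc _ ≤ (⌊(m : ℝ≥0) * t⌋₊ : ℝ) * ((Real.log c * k / m) / d) ^ 2 := by gcongr
    _ = _ := by field_simp

lemma tendsto_measureReal_le_abs_sub (hc : 1 < c) (ha : 0 ≤ a) (hb : 0 ≤ b)
    (hab : ¬(a = 0 ∧ b = 0)) (hpos : ∀ m, 0 < A₀ m + B₀ m)
    (hA₀ : Tendsto (fun m : ℕ+ => (A₀ m : ℝ) / m) atTop (𝓝 a))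
    (hB₀ : Tendsto (fun m : ℕ+ => (B₀ m : ℝ) / m) atTop (𝓝 b))
    (hurn : ∀ m : ℕ+, IsQPolyaUrn (P m) (c ^ (1 / (m : ℝ))) k (A₀ m) (B₀ m) (A m) (B m))
    (t : ℝ≥0) {ε : ℝ} (hε : 0 < ε) :
    Tendsto (fun m : ℕ+ => (P m).real
      {ω | ε ≤ |(A m ⌊(m : ℝ≥0) * t⌋₊ ω : ℝ) / m - qPolyaLimit c a b k t|}) atTop (𝓝 0) := by
  have hc0 : 0 < c := by linarith
  have hab0 := add_pos_of_not_both_zero ha hb hab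
  have hcont : Continuous fun x : ℝ => c ^ (-x) :=
    (Real.continuous_const_rpow hc0.ne').comp continuous_neg
  have hD : 1 - c ^ (-(a + b)) ≠ 0 :=
    (sub_pos.2 (Real.rpow_lt_one_of_one_lt_of_neg hc (by linarith))).ne'
  set x := qPolyaLimit c a b k t with hx
  -- A deviation `ε` of `A / m` from `x` moves `c ^ (-A / m)` by at least `η`. The deterministic
  -- error `hdet` uses at most half of it, leaving `η / 2` for the martingale and Chebyshev.
  set η := c ^ (-x) * (1 - c ^ (-ε)) with hη
  have hη0 : 0 < η := mul_pos (Real.rpow_pos_of_pos hc0 _)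
    (sub_pos.2 (Real.rpow_lt_one_of_one_lt_of_neg hc (by linarith)))
  -- The martingale's denominator at time `[m t]`, almost surely deterministic because the total is.
  set D : ℕ+ → ℝ := fun m =>
    1 - c ^ (-((A₀ m : ℝ) / m + (B₀ m : ℝ) / m + k * ((⌊(m : ℝ≥0) * t⌋₊ : ℝ) / m))) with hDdef
  have hdet : Tendsto (fun m : ℕ+ => (1 - c ^ (-((A₀ m : ℝ) / m))) /
      (1 - c ^ (-((A₀ m : ℝ) / m + (B₀ m : ℝ) / m))) * D m) atTop (𝓝 (1 - c ^ (-x))) := by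
    rw [hx, rpow_neg_qPolyaLimit hc ha hb hab, sub_sub_cancel]
    exact ((tendsto_const_nhds.sub ((hcont.tendsto _).comp hA₀)).div (tendsto_const_nhds.sub
      ((hcont.tendsto _).comp (hA₀.add hB₀))) hD).mul (tendsto_const_nhds.sub
      ((hcont.tendsto _).comp ((hA₀.add hB₀).add ((tendsto_floor_mul_div_pnat t).const_mul _))))
  have hint := (tendsto_integral_sq_martingale_sub hc hab0 hpos hA₀ hB₀ hurn t).div_const
    ((η / 2) ^ 2)
  rw [zero_div] at hint
  refine squeeze_zero' (Eventually.of_forall fun m => measureReal_nonneg) ?_ hint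
  filter_upwards [hdet.eventually (Metric.ball_mem_nhds _ (half_pos hη0))] with m hm
  have hm0 : (0 : ℝ) < m := by exact_mod_cast m.pos
  have hq : 1 < c ^ (1 / (m : ℝ)) := Real.one_lt_rpow hc (by positivity)
  set q := c ^ (1 / (m : ℝ)) with hqdef
  set n := ⌊(m : ℝ≥0) * t⌋₊ with hn
  set μ := qPolyaMartingale q (A₀ m, B₀ m) with hμ
  have hμ' : μ = (1 - c ^ (-((A₀ m : ℝ) / m))) /
      (1 - c ^ (-((A₀ m : ℝ) / m + (B₀ m : ℝ) / m))) := by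
    simp only [hμ, qPolyaMartingale, hqdef]
    rw [rpow_one_div_rpow_neg hc0.le, rpow_one_div_rpow_neg hc0.le, add_div]
  rw [← hμ', Real.dist_eq] at hm
  have hM0 := qPolyaMartingale_nonneg hq
  have hM1 := qPolyaMartingale_le_one hq
  have hsq : Integrable (fun ω => (qPolyaMartingale q (A m n ω, B m n ω) - μ) ^ 2) (P m) := by
    refine Integrable.of_bound ((measurable_of_countable
      (fun z => (qPolyaMartingale q z - μ) ^ 2)).comp
        ((hurn m).measurable_state n)).aestronglyMeasurable 1 (Eventually.of_forall fun ω => ?_)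
    rw [Real.norm_eq_abs, abs_pow, sq_le_one_iff_abs_le_one, abs_abs]
    exact abs_le.2 ⟨by linarith [hM0 (A m n ω, B m n ω), hM1 (A₀ m, B₀ m)],
      by linarith [hM1 (A m n ω, B m n ω), hM0 (A₀ m, B₀ m)]⟩
  have hcheb := mul_meas_ge_le_integral_of_nonneg (μ := P m)
    (Eventually.of_forall fun ω => sq_nonneg (qPolyaMartingale q (A m n ω, B m n ω) - μ)) hsq
    ((η / 2) ^ 2)
  rw [le_div_iff₀ (by positivity), mul_comm]
  refine le_trans ?_ hcheb
  refine mul_le_mul_of_nonneg_left ?_ (by positivity)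
  refine ENNReal.toReal_mono (measure_ne_top _ _) (measure_mono_ae ?_)
  filter_upwards [(hurn m).ae_add_eq] with ω hω hle
  have hN : ((A m n ω : ℝ) + B m n ω) / m =
      (A₀ m : ℝ) / m + (B₀ m : ℝ) / m + k * ((n : ℝ) / m) := by
    have : (A m n ω : ℝ) + B m n ω = A₀ m + B₀ m + k * n := by exact_mod_cast hω n
    rw [this]
    ring
  have hDpos : 0 < D m := by
    refine sub_pos.2 (Real.rpow_lt_one_of_one_lt_of_neg hc (neg_neg_of_pos ?_))
    have h1 : (0 : ℝ) < (A₀ m : ℝ) / m + (B₀ m : ℝ) / m := by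
      rw [← add_div]
      exact div_pos (by exact_mod_cast hpos m) hm0
    positivity
  have hD1 : D m ≤ 1 := sub_le_self _ (Real.rpow_nonneg hc0.le _)
  have hMD : c ^ (-((A m n ω : ℝ) / m)) = 1 - qPolyaMartingale q (A m n ω, B m n ω) * D m := by
    simp only [qPolyaMartingale, hqdef]
    rw [rpow_one_div_rpow_neg hc0.le, rpow_one_div_rpow_neg hc0.le, hN, div_mul_cancel₀ _ hDpos.ne']
    ring
  have h1 := le_abs_rpow_neg_sub hc hle
  rw [hMD] at h1
  set M := qPolyaMartingale q (A m n ω, B m n ω)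
  have h2 : |1 - M * D m - c ^ (-x)| ≤ |M - μ| + |μ * D m - (1 - c ^ (-x))| := by
    have e : 1 - M * D m - c ^ (-x) = -((M - μ) * D m + (μ * D m - (1 - c ^ (-x)))) := by ring
    rw [e, abs_neg]
    refine (abs_add_le _ _).trans (add_le_add_left ?_ _)
    rw [abs_mul, abs_of_pos hDpos]
    exact mul_le_of_le_one_right (abs_nonneg _) hD1
  have h3 : η / 2 ≤ |M - μ| := by linarith
  change (η / 2) ^ 2 ≤ (M - μ) ^ 2
  rw [← sq_abs (M - μ)]
  gcongr

end

/-! ### Assembly of the theorem -/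

theorem theorem1p8 (c a b : ℝ) (hc : 1 < c) (ha : 0 ≤ a) (hb : 0 ≤ b) (hab : ¬(a = 0 ∧ b = 0))
    (k : ℕ) (hk : 0 < k)
    (A₀ B₀ : ℕ+ → ℕ) (hpos : ∀ m, 0 < A₀ m + B₀ m)
    (hA₀ : Tendsto (fun m : ℕ+ => (A₀ m : ℝ) / m) atTop (𝓝 a))
    (hB₀ : Tendsto (fun m : ℕ+ => (B₀ m : ℝ) / m) atTop (𝓝 b))
    {Ω : ℕ+ → Type*} [∀ m, MeasurableSpace (Ω m)]
    (P : (m : ℕ+) → Measure (Ω m)) [∀ m, IsProbabilityMeasure (P m)]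
    (A B : (m : ℕ+) → ℕ → Ω m → ℕ)
    (hurn : ∀ m : ℕ+, IsQPolyaUrn (P m) (c ^ (1 / (m : ℝ))) k (A₀ m) (B₀ m) (A m) (B m)) :
    IsQPolyaODESolution c a b k (qPolyaLimit c a b k) ∧
    (∀ X : ℝ → ℝ, IsQPolyaODESolution c a b k X → ∀ t : ℝ, 0 ≤ t → X t = qPolyaLimit c a b k t) ∧
    ∃ X : SkorokhodSpace, (∀ t : ℝ≥0, X t = qPolyaLimit c a b k t) ∧
      TendstoInDistribution (fun m ω => rescaledPath m (fun n => A m n ω)) atTop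
        (fun _ : Unit => X) P (Measure.dirac ()) := by
  have hcont : Continuous fun t : ℝ≥0 => qPolyaLimit c a b k t :=
    (continuous_qPolyaLimit hc ha hb hab k).comp NNReal.continuous_coe
  refine ⟨isQPolyaODESolution_qPolyaLimit hc ha hb hab,
    fun X hX t ht => hX.eq_qPolyaLimit hc ha hb hab ht, ⟨_, hcont.isCadlag⟩, fun t => rfl, ?_⟩
  have hmeas : ∀ m, Measurable fun ω => rescaledPath m (fun n => A m n ω) := fun m =>
    (continuous_rescaledPath m).measurable.comp
      (measurable_pi_lambda _ fun n => (hurn m).measurable_white n)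
  refine tendstoInDistribution_dirac_of_forall_isOpen (fun m => (hmeas m).aemeasurable)
    fun U hU hXU => ?_
  obtain ⟨T, ε, hε, hTU⟩ := hU _ hXU
  obtain ⟨I, hI⟩ := exists_finset_forall_abs_sub_lt hcont T hε
  have hsum := tendsto_finsetSum I fun t _ => tendsto_measureReal_le_abs_sub hc ha hb hab hpos
    hA₀ hB₀ hurn t (half_pos hε)
  rw [Finset.sum_const_zero] at hsum
  rw [← ENNReal.tendsto_toReal_iff (fun m => measure_ne_top _ _) ENNReal.one_ne_top,
    ENNReal.toReal_one]
  have hlow := hsum.const_sub 1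
  rw [sub_zero] at hlow
  refine tendsto_of_tendsto_of_tendsto_of_le_of_le hlow tendsto_const_nhds (fun m => ?_)
    fun m => measureReal_le_one
  have hcompl := probReal_compl_eq_one_sub (μ := P m) (hmeas m hU.measurableSet)
  suffices h : (P m).real ((fun ω => rescaledPath m (fun n => A m n ω)) ⁻¹' U)ᶜ ≤
      ∑ t ∈ I, (P m).real
        {ω | ε / 2 ≤ |(A m ⌊(m : ℝ≥0) * t⌋₊ ω : ℝ) / m - qPolyaLimit c a b k t|} by
    change _ ≤ (P m).real _
    linarith
  -- Almost surely, a path outside `U` deviates by at least `ε / 2` at some time of `I`; otherwise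
  -- monotonicity would make it uniformly close on `[0, T]`, hence in `U`.
  refine le_trans ?_ (measureReal_biUnion_finset_le I _)
  refine ENNReal.toReal_mono (measure_ne_top _ _) (measure_mono_ae ?_)
  filter_upwards [(hurn m).ae_monotone] with ω hmono hω
  by_contra hbad
  refine hω (hTU (SkorokhodSpace.mem_basicNhd_of_forall_abs_lt hε (hI _ ?_ fun t ht => ?_)))
  · intro s t hst
    have : A m ⌊(m : ℝ≥0) * s⌋₊ ω ≤ A m ⌊(m : ℝ≥0) * t⌋₊ ω :=
      hmono (Nat.floor_mono (by gcongr))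
    simp only [rescaledPath]
    gcongr
  · by_contra hlt
    exact hbad (mem_biUnion ht (not_lt.1 hlt))
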